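/- Let $n\ge 1$ be an integer and let $X$ be a separable metric space such that - $X$ is $(n-1)$-connected: $X$ is non-empty and path connected, and $\pi_k(X,x)$ is trivial for all $1\le k\le n-1$ and all $x\in X$; - $X$ is locally $(n-1)$-connected: every neighbourhood $U$ of every point $x\in X$ contains a neighbourhood $V$ of $x$ such that, for each $0\le k\le n-1$, every continuous map $S^k\to V$ extends to a continuous map $D^{k+1}\to U$; - $X$ is semilocally $n$-connected: every point $x\in X$ has a neighbourhood $U$ such that the homomorphism $\pi_n(U,x)\to\pi_n(X,x)$ induced by the inclusion is trivial. Then the homotopy group $\pi_n(X,x)$ is countable for every $x\in X$. -/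

import Mathlib

open scoped Topology unitInterval Topology.Homotopy

/-- The map `Ω^N(X, x) → Ω^N(Y, f x)` given by composition with a continuous map `f`. -/
def GenLoop.postcomp {N X Y : Type*} [TopologicalSpace X] [TopologicalSpace Y]
    (f : C(X, Y)) (x : X) (p : Ω^ N X x) : Ω^ N Y (f x) :=
  ⟨f.comp p.1, fun t ht => congrArg f (p.2 t ht)⟩

/-- The map `π_n(X, x) → π_n(Y, f x)` induced by a continuous map `f`. -/
def HomotopyGroup.induced {X Y : Type*} [TopologicalSpace X] [TopologicalSpace Y]
    (n : ℕ) (f : C(X, Y)) (x : X) : π_ n X x → π_ n Y (f x) :=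
  Quotient.map (GenLoop.postcomp f x) fun _ _ h =>
    ContinuousMap.HomotopicRel.comp_continuousMap h f

/-- `X` is `m`-connected: it is (non-empty and) path connected, and `π_k(X, x)` is trivial for
all `1 ≤ k ≤ m` and all base points `x`. -/
def IsNConnected (m : ℕ) (X : Type*) [TopologicalSpace X] : Prop :=
  PathConnectedSpace X ∧ ∀ k : ℕ, 1 ≤ k → k ≤ m → ∀ x : X, Subsingleton (π_ k X x)

/-- `X` is locally `m`-connected (`LC^m`): every neighbourhood `U` of every point `x` contains a
neighbourhood `V` of `x` such that, for all `0 ≤ k ≤ m`, every map of a `k`-sphere into `V` extends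
to a map of the `(k+1)`-ball into `U`. The pair (ball, sphere) is modelled by the cube `I^(k+1)`
and its boundary; for `k = 0` the latter consists of two points. -/
def IsLocallyNConnected (m : ℕ) (X : Type*) [TopologicalSpace X] : Prop :=
  ∀ x : X, ∀ U ∈ 𝓝 x, ∃ V ∈ 𝓝 x, V ⊆ U ∧ ∀ k ≤ m,
    ∀ f : C(Cube.boundary (Fin (k + 1)), X), (∀ t, f t ∈ V) →
      ∃ g : C(Fin (k + 1) → I, X), (∀ t, g t ∈ U) ∧ ∀ t : Cube.boundary (Fin (k + 1)), g t = f t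

/-- `X` is semilocally `n`-connected at `x`: some neighbourhood `U` of `x` is such that the map
`π_n(U, x) → π_n(X, x)` induced by the inclusion is trivial. -/
def IsSemilocallyNConnectedAt (n : ℕ) (X : Type*) [TopologicalSpace X] (x : X) : Prop :=
  ∃ U : Set X, ∃ hU : U ∈ 𝓝 x, ∀ a : π_ n U ⟨x, mem_of_mem_nhds hU⟩,
    HomotopyGroup.induced n (⟨Subtype.val, continuous_subtype_val⟩ : C(U, X))
      ⟨x, mem_of_mem_nhds hU⟩ a = (⟦GenLoop.const⟧ : π_ n X x)

/-- `X` is semilocally `n`-connected: it is so at every point. -/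
def IsSemilocallyNConnected (n : ℕ) (X : Type*) [TopologicalSpace X] : Prop :=
  ∀ x : X, IsSemilocallyNConnectedAt n X x

/-! Countability reduces to a local statement about the loop space `Ω^n X`. It is second countable
because `X` is, so a countable dense set of loops meets every path component once each loop has a
neighbourhood of loops joined to it by paths (`HomotopyGroup.countable_of_isSemilocallyExtendable`).

That property is semilocal extendability in degree 0, obtained by trading degrees for loop
coordinates. If spheres of dimensions `m` and `m + 1` can be filled locally in a space, then
`m`-spheres can be filled locally in its path spaces; the same holds if the fillings in degree `m +
1`, and hence those of paths, are only semilocal. The reason is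
`ExtendsOver.exists_family_of_paths`: cut the time interval finely, fill an `m`-sphere at each
division point, then fill the prisms between them. Iterating `n` times (`GenLoop.isExtendable`)
descends from degree `n` on `X` to degree 0 on `Ω^n X`.

The hypothesis on `π_n` concerns based loops, whereas the induction needs fillings of free
`n`-spheres; `ExtendsOver.of_induced_eq_const` converts one into the other by the homotopy extension
property. -/

/-! ### Filling boundaries of cubes and prisms -/

/-- Every map from the boundary of the `(k + 1)`-cube into `V` extends to a map of the whole cube
into `U`. -/
def ExtendsOver {X : Type*} [TopologicalSpace X] (k : ℕ) (V U : Set X) : Prop :=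
  ∀ f : (Fin (k + 1) → I) → X, ContinuousOn f (Cube.boundary (Fin (k + 1))) →
    Set.MapsTo f (Cube.boundary (Fin (k + 1))) V →
      ∃ g : (Fin (k + 1) → I) → X, Continuous g ∧ (∀ t, g t ∈ U) ∧
        Set.EqOn g f (Cube.boundary (Fin (k + 1)))

theorem ExtendsOver.mono {X : Type*} [TopologicalSpace X] {k : ℕ} {V V' U U' : Set X}
    (h : ExtendsOver k V U) (hV : V' ⊆ V) (hU : U ⊆ U') : ExtendsOver k V' U' := by
  intro f hf hfV
  obtain ⟨g, hg, hgU, hgf⟩ := h f hf (hfV.mono_right hV)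
  exact ⟨g, hg, fun t => hU (hgU t), hgf⟩

theorem Cube.cons_mem_boundary_iff {m : ℕ} {r : I} {s : Fin m → I} :
    (Fin.cons r s : Fin (m + 1) → I) ∈ Cube.boundary (Fin (m + 1)) ↔
      r = 0 ∨ r = 1 ∨ s ∈ Cube.boundary (Fin m) := by
  simp [Cube.boundary, Fin.exists_fin_succ, or_assoc]

theorem Cube.isClosed_boundary (N : Type*) [Finite N] : IsClosed (Cube.boundary N) := by
  have : Cube.boundary N = ⋃ i, {y : N → I | y i = 0 ∨ y i = 1} := by
    ext y; simp [Cube.boundary]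
  rw [this]
  refine isClosed_iUnion_of_finite fun i => ?_
  exact (isClosed_eq (by fun_prop) (by fun_prop)).union (isClosed_eq (by fun_prop) (by fun_prop))

open Classical in
/-- A map prescribed on the bottom, the top, and the sides of the prism `I^m × I` extends over the
prism whenever maps of the boundary of the `(m + 1)`-cube extend. -/
theorem ExtendsOver.exists_prism {X : Type*} [TopologicalSpace X] {m : ℕ} {V T : Set X}
    (h : ExtendsOver m V T) (F : (Fin m → I) → I → X)
    (hF : ContinuousOn (Function.uncurry F) (Cube.boundary (Fin m) ×ˢ Set.univ))
    {D₀ D₁ : (Fin m → I) → X} (hD₀ : Continuous D₀) (hD₁ : Continuous D₁)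
    (h₀ : ∀ s ∈ Cube.boundary (Fin m), D₀ s = F s 0)
    (h₁ : ∀ s ∈ Cube.boundary (Fin m), D₁ s = F s 1)
    (hV : ∀ s ∈ Cube.boundary (Fin m), ∀ r, F s r ∈ V)
    (hV₀ : ∀ s, D₀ s ∈ V) (hV₁ : ∀ s, D₁ s ∈ V) :
    ∃ H : (Fin m → I) → I → X, Continuous (Function.uncurry H) ∧ (∀ s r, H s r ∈ T) ∧
      (∀ s, H s 0 = D₀ s) ∧ (∀ s, H s 1 = D₁ s) ∧
      ∀ s ∈ Cube.boundary (Fin m), H s = F s := by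
  set f : (Fin (m + 1) → I) → X := fun z =>
    if z 0 = 0 then D₀ (Fin.tail z) else if z 0 = 1 then D₁ (Fin.tail z)
    else F (Fin.tail z) (z 0) with hf
  have htail : Continuous (fun z : Fin (m + 1) → I => Fin.tail z) := by
    unfold Fin.tail; fun_prop
  have f0 : ∀ s, f (Fin.cons 0 s) = D₀ s := fun s => by simp [hf]
  have f1 : ∀ s, f (Fin.cons 1 s) = D₁ s := fun s => by simp [hf]
  have fs : ∀ s ∈ Cube.boundary (Fin m), ∀ r, f (Fin.cons r s) = F s r := by
    intro s hs r
    by_cases hr0 : r = 0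
    · subst hr0; rw [f0, h₀ s hs]
    by_cases hr1 : r = 1
    · subst hr1; rw [f1, h₁ s hs]
    simp [hf, hr0, hr1]
  have hbd : Cube.boundary (Fin (m + 1)) = ({z | z 0 = 0} ∪ {z | z 0 = 1}) ∪
      (fun z : Fin (m + 1) → I => Fin.tail z) ⁻¹' Cube.boundary (Fin m) := by
    ext z
    induction z using Fin.consCases with
    | cons r s => simp [Cube.cons_mem_boundary_iff, or_assoc]
  have c0 : ContinuousOn f {z | z 0 = 0} := by
    refine (hD₀.comp htail).continuousOn.congr fun z hz => ?_
    simp only [Set.mem_ofPred_eq] at hz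
    simp [hf, hz]
  have c1 : ContinuousOn f {z | z 0 = 1} := by
    refine (hD₁.comp htail).continuousOn.congr fun z hz => ?_
    simp only [Set.mem_ofPred_eq] at hz
    simp [hf, hz]
  have c2 : ContinuousOn f
      ((fun z : Fin (m + 1) → I => Fin.tail z) ⁻¹' Cube.boundary (Fin m)) := by
    have : ContinuousOn (fun z : Fin (m + 1) → I => Function.uncurry F (Fin.tail z, z 0))
        ((fun z : Fin (m + 1) → I => Fin.tail z) ⁻¹' Cube.boundary (Fin m)) :=
      hF.comp (htail.prodMk (continuous_apply 0)).continuousOn fun z hz => ⟨hz, trivial⟩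
    refine this.congr fun z hz => ?_
    have := fs _ hz (z 0)
    rwa [Fin.cons_self_tail] at this
  have k0 : IsClosed {z : Fin (m + 1) → I | z 0 = 0} :=
    isClosed_eq (continuous_apply 0) continuous_const
  have k1 : IsClosed {z : Fin (m + 1) → I | z 0 = 1} :=
    isClosed_eq (continuous_apply 0) continuous_const
  have k2 := (Cube.isClosed_boundary (Fin m)).preimage htail
  obtain ⟨g, hg, hgT, hgf⟩ := h f
    (by rw [hbd]; exact (c0.union_of_isClosed c1 k0 k1).union_of_isClosed c2 (k0.union k1) k2)
    (by
      intro z hz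
      induction z using Fin.consCases with
      | cons r s =>
        rcases Cube.cons_mem_boundary_iff.1 hz with rfl | rfl | hs
        · rw [f0]; exact hV₀ s
        · rw [f1]; exact hV₁ s
        · rw [fs s hs]; exact hV s hs r)
  refine ⟨fun s r => g (Fin.cons r s), ?_, fun s r => hgT _, fun s => ?_, fun s => ?_,
    fun s hs => funext fun r => ?_⟩
  · exact hg.comp (Continuous.finCons continuous_snd continuous_fst)
  · exact (hgf (Cube.cons_mem_boundary_iff.2 (Or.inl rfl))).trans (f0 s)
  · exact (hgf (Cube.cons_mem_boundary_iff.2 (Or.inr (Or.inl rfl)))).trans (f1 s)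
  · exact (hgf (Cube.cons_mem_boundary_iff.2 (Or.inr (Or.inr hs)))).trans (fs s hs r)

/-! ### Filling spheres of paths by subdividing time -/

open Metric in
/-- A family of paths from `x` to `y`, indexed by the boundary of a cube and close to a given path
`p`, extends to a family of paths indexed by the cube. -/
theorem ExtendsOver.exists_family_of_paths {X : Type*} [PseudoMetricSpace X] {m : ℕ} {x y : X}
    (p : Path x y) {η δ : ℝ} (hη : 0 < η) (hδη : δ ≤ η / 2)
    (h₁ : ∀ t, ExtendsOver m (ball (p t) δ) (ball (p t) (η / 2)))
    (T : I → Set X) (hpT : ∀ t, p t ∈ T t) (h₂ : ∀ t, ExtendsOver (m + 1) (ball (p t) η) (T t))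
    (F : (Fin (m + 1) → I) → I → X)
    (hF : ContinuousOn (Function.uncurry F) (Cube.boundary (Fin (m + 1)) ×ˢ Set.univ))
    (hF₀ : ∀ s ∈ Cube.boundary (Fin (m + 1)), F s 0 = x)
    (hF₁ : ∀ s ∈ Cube.boundary (Fin (m + 1)), F s 1 = y)
    (hFp : ∀ s ∈ Cube.boundary (Fin (m + 1)), ∀ t, F s t ∈ ball (p t) δ) :
    ∃ G : (Fin (m + 1) → I) → I → X, Continuous (Function.uncurry G) ∧
      (∀ s ∈ Cube.boundary (Fin (m + 1)), G s = F s) ∧ (∀ s, G s 0 = x) ∧ (∀ s, G s 1 = y) ∧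
      ∀ s t, ∃ t', dist (p t) (p t') < η / 2 ∧ G s t ∈ T t' := by
  obtain ⟨ε, hε, hpε⟩ := Metric.uniformContinuous_iff.1
    (CompactSpace.uniformContinuous_of_continuous p.continuous) (η / 2) (half_pos hη)
  obtain ⟨N, hN⟩ := exists_nat_gt (1 / ε)
  have hN0 : (0 : ℝ) < N := lt_trans (by positivity) hN
  have hNε : 1 / (N : ℝ) < ε := by
    rw [div_lt_iff₀ hN0]; rwa [div_lt_iff₀ hε, mul_comm] at hN
  set τ : ℝ → I := Set.projIcc 0 1 zero_le_one with hτ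
  have hτc : Continuous τ := continuous_projIcc
  have hτd : ∀ a b : ℝ, |a - b| ≤ 1 / N → dist (p (τ a)) (p (τ b)) < η / 2 := by
    intro a b hab
    refine hpε (lt_of_le_of_lt ?_ (lt_of_le_of_lt hab hNε))
    exact (Set.abs_projIcc_sub_projIcc (h := zero_le_one))
  have hτ0 : τ 0 = 0 := Set.projIcc_left _
  have hτ1 : τ 1 = 1 := Set.projIcc_right _
  have hFt : ∀ t, ContinuousOn (fun s => F s t) (Cube.boundary (Fin (m + 1))) := fun t =>
    hF.comp (f := fun s => (s, t)) (by fun_prop) fun s hs => ⟨hs, trivial⟩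
  -- Slices at the division points. The first and last must be constant, so that the result consists
  -- of paths from `x` to `y`; only the intermediate ones come from `h₁`.
  have hvert : ∀ i : ℕ, ∃ D : (Fin (m + 1) → I) → X, Continuous D ∧
      (∀ s, D s ∈ ball (p (τ (i / N))) (η / 2)) ∧
      (∀ s ∈ Cube.boundary (Fin (m + 1)), D s = F s (τ (i / N))) ∧
      (i = 0 → ∀ s, D s = x) ∧ (i = N → ∀ s, D s = y) := by
    intro i
    by_cases hi0 : i = 0
    · subst hi0
      refine ⟨fun _ => x, continuous_const, fun s => ?_, fun s hs => ?_, fun _ _ => rfl, ?_⟩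
      · simp [hτ0, hη]
      · simp [hτ0, hF₀ s hs]
      · rintro h
        exact absurd (by exact_mod_cast h.symm) hN0.ne'
    by_cases hiN : i = N
    · subst hiN
      refine ⟨fun _ => y, continuous_const, fun s => ?_, fun s hs => ?_, ?_, fun _ _ => rfl⟩
      · simp [div_self hN0.ne', hτ1, hη]
      · simp [div_self hN0.ne', hτ1, hF₁ s hs]
      · exact fun h => absurd h hi0
    · obtain ⟨D, hD, hDV, hDF⟩ := h₁ (τ (i / N)) _ (hFt (τ (i / N))) fun s hs => hFp s hs _
      exact ⟨D, hD, hDV, hDF, fun h => absurd h hi0, fun h => absurd h hiN⟩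
  choose D hD hDV hDF hD0 hDN using hvert
  -- Real time keeps `G` globally continuous, so that gluing is a plain case split; it is controlled
  -- only up to `i / N`.
  have hstep : ∀ i : ℕ, ∃ G : (Fin (m + 1) → I) → ℝ → X, Continuous (Function.uncurry G) ∧
      (∀ s ∈ Cube.boundary (Fin (m + 1)), ∀ t ∈ Set.Icc (0 : ℝ) (i / N), G s t = F s (τ t)) ∧
      (∀ s, G s 0 = x) ∧ (∀ s, G s (i / N) = D i s) ∧
      ∀ s, ∀ t ∈ Set.Icc (0 : ℝ) (i / N),
        ∃ t', dist (p (τ t)) (p t') < η / 2 ∧ G s t ∈ T t' := by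
    intro i
    induction i with
    | zero =>
      refine ⟨fun s t => D 0 s, (hD 0).comp continuous_fst, fun s hs t ht => ?_, hD0 0 rfl,
        fun s => rfl, fun s t ht => ⟨0, ?_, ?_⟩⟩
      · obtain rfl : t = 0 := le_antisymm (by simpa using ht.2) ht.1
        simp [hDF 0 s hs]
      · obtain rfl : t = 0 := le_antisymm (by simpa using ht.2) ht.1
        simp [hτ0, hη]
      · simpa only [hD0 0 rfl, p.source] using hpT 0
    | succ i ih =>
      obtain ⟨G, hG, hGF, hG0, hGD, hGT⟩ := ih
      have hinc : ∀ r : I, |((i + r : ℝ) / N) - i / N| ≤ 1 / N := fun r => by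
        rw [← sub_div, add_sub_cancel_left, abs_of_nonneg (div_nonneg r.2.1 hN0.le)]
        exact div_le_div_of_nonneg_right r.2.2 hN0.le
      have hsub : ball (p (τ (i / N))) (η / 2) ⊆ ball (p (τ (i / N))) η :=
        ball_subset_ball (by linarith)
      have hsub' : ∀ r : I, ball (p (τ ((i + r : ℝ) / N))) (η / 2) ⊆ ball (p (τ (i / N))) η :=
        fun r => ball_subset_ball' (by linarith [hτd _ _ (hinc r)])
      -- The walls of the prism over `[i / N, (i + 1) / N]` lie within `η / 2` of points of `p` that
      -- are themselves within `η / 2` of `p (τ (i / N))`, so `h₂` fills it.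
      obtain ⟨H, hH, hHT, hH0, hH1, hHF⟩ := (h₂ (τ (i / N))).exists_prism
        (fun s r => F s (τ ((i + r : ℝ) / N)))
        (hF.comp (f := fun z : (Fin (m + 1) → I) × I => (z.1, τ ((i + z.2 : ℝ) / N)))
          (Continuous.continuousOn (by fun_prop)) fun z hz => ⟨hz.1, trivial⟩)
        (hD i) (hD (i + 1)) (fun s hs => by simp [hDF i s hs])
        (fun s hs => by simp [hDF (i + 1) s hs])
        (fun s hs r => hsub' r (ball_subset_ball hδη (hFp s hs _)))
        (fun s => hsub (hDV i s))
        (fun s => hsub' 1 (by simpa using hDV (i + 1) s))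
      have hin : (0 : ℝ) ≤ i / N := by positivity
      have hHt : ∀ t ∈ Set.Icc ((i : ℝ) / N) ((i + 1 : ℕ) / N),
          ((i : ℝ) + τ (N * t - i)) / N = t := by
        intro t ht
        have h1 : (i : ℝ) ≤ N * t := by rw [mul_comm]; exact (div_le_iff₀ hN0).1 ht.1
        have h2 : N * t ≤ (i : ℝ) + 1 := by
          rw [mul_comm]; exact_mod_cast (le_div_iff₀ hN0).1 ht.2
        rw [hτ, Set.projIcc_of_mem zero_le_one ⟨by linarith, by linarith⟩]
        field_simp; ring
      refine ⟨fun s t => if t ≤ i / N then G s t else H s (τ (N * t - i)), ?_, ?_, ?_, ?_, ?_⟩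
      · refine Continuous.if_le (f := fun z : (Fin (m + 1) → I) × ℝ => z.2)
          (f' := fun z => Function.uncurry G z)
          (g' := fun z => Function.uncurry H (z.1, τ (N * z.2 - i)))
          hG (by fun_prop) continuous_snd continuous_const ?_
        rintro ⟨s, t⟩ (rfl : t = i / N)
        simp [hGD, mul_div_cancel₀ _ hN0.ne', hτ0, hH0]
      · intro s hs t ht
        dsimp only
        split_ifs with hti
        · exact hGF s hs t ⟨ht.1, hti⟩
        · simp only [hHF s hs]
          rw [hHt t ⟨(not_le.1 hti).le, ht.2⟩]
      · intro s
        simp [hin, hG0]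
      · intro s
        have h1 : ¬ (((i + 1 : ℕ) : ℝ) / N ≤ i / N) := by
          rw [div_le_div_iff_of_pos_right hN0]; simp
        have h2 : (N : ℝ) * (((i + 1 : ℕ) : ℝ) / N) - i = 1 := by
          rw [mul_div_cancel₀ _ hN0.ne']; simp
        simp only [h1, if_false, h2, hτ1, hH1]
      · intro s t ht
        dsimp only
        split_ifs with hti
        · exact hGT s t ⟨ht.1, hti⟩
        · refine ⟨τ (i / N), ?_, hHT _ _⟩
          have h := hHt t ⟨(not_le.1 hti).le, ht.2⟩
          rw [← h]
          exact hτd _ _ (hinc _)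
  obtain ⟨G, hG, hGF, hG0, hGD, hGT⟩ := hstep N
  rw [div_self hN0.ne'] at hGF hGD hGT
  have hτv : ∀ t : I, τ t = t := fun t => Set.projIcc_val _ _
  refine ⟨fun s t => G s t, ?_, fun s hs => funext fun t => ?_, fun s => hG0 s, fun s => ?_,
    fun s t => ?_⟩
  · exact hG.comp (f := fun z : (Fin (m + 1) → I) × I => (z.1, (z.2 : ℝ))) (by fun_prop)
  · simpa only [hτv] using hGF s hs t t.2
  · exact (hGD s).trans (hDN N rfl s)
  · have := hGT s t t.2
    rwa [hτv] at this

/-! ### Local and semilocal extendability -/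

/-- Every point has a neighbourhood `V ⊆ U` such that maps of the `k`-sphere into `V` extend to
the ball in `U`, for each neighbourhood `U`. -/
def IsLocallyExtendable (k : ℕ) (X : Type*) [TopologicalSpace X] : Prop :=
  ∀ x : X, ∀ U ∈ 𝓝 x, ∃ V ∈ 𝓝 x, ExtendsOver k V U

/-- Every point has a neighbourhood `V` such that maps of the `k`-sphere into `V` extend to
the ball in `X`. -/
def IsSemilocallyExtendable (k : ℕ) (X : Type*) [TopologicalSpace X] : Prop :=
  ∀ x : X, ∃ V ∈ 𝓝 x, ExtendsOver k V Set.univ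

theorem ExtendsOver.preimage_homeomorph {X Y : Type*} [TopologicalSpace X] [TopologicalSpace Y]
    (e : X ≃ₜ Y) {k : ℕ} {V U : Set Y} (h : ExtendsOver k V U) :
    ExtendsOver k (e ⁻¹' V) (e ⁻¹' U) := by
  intro f hf hfV
  obtain ⟨g, hg, hgU, hgf⟩ := h (e ∘ f) (e.continuous.comp_continuousOn hf) hfV
  refine ⟨e.symm ∘ g, e.symm.continuous.comp hg, fun t => by simpa using hgU t, fun t ht => ?_⟩
  simp [hgf ht]

theorem IsLocallyExtendable.of_homeomorph {X Y : Type*} [TopologicalSpace X] [TopologicalSpace Y]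
    (e : X ≃ₜ Y) {k : ℕ} (h : IsLocallyExtendable k Y) : IsLocallyExtendable k X := by
  intro x U hU
  obtain ⟨V, hV, hVU⟩ := h (e x) (e.symm ⁻¹' U)
    (e.symm.continuous.continuousAt.preimage_mem_nhds (by simpa using hU))
  refine ⟨e ⁻¹' V, e.continuous.continuousAt.preimage_mem_nhds hV, ?_⟩
  refine (hVU.preimage_homeomorph e).mono subset_rfl fun z hz => ?_
  simpa using hz

theorem IsSemilocallyExtendable.of_homeomorph {X Y : Type*} [TopologicalSpace X]
    [TopologicalSpace Y] (e : X ≃ₜ Y) {k : ℕ} (h : IsSemilocallyExtendable k Y) :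
    IsSemilocallyExtendable k X := by
  intro x
  obtain ⟨V, hV, hVU⟩ := h (e x)
  exact ⟨e ⁻¹' V, e.continuous.continuousAt.preimage_mem_nhds hV, hVU.preimage_homeomorph e⟩

open Metric

/-- A Lebesgue number of a cover by good neighbourhoods serves all of `K`. Halving `ε` allows for
recentring the target ball. -/
theorem IsLocallyExtendable.exists_uniform {X : Type*} [PseudoMetricSpace X] {k : ℕ}
    (h : IsLocallyExtendable k X) {K : Set X} (hK : IsCompact K) {ε : ℝ} (hε : 0 < ε) :
    ∃ δ > 0, ∀ x ∈ K, ExtendsOver k (ball x δ) (ball x ε) := by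
  choose V hV hVU using fun x => h x (ball x (ε / 2)) (ball_mem_nhds x (half_pos hε))
  obtain ⟨δ, hδ, hδV⟩ := lebesgue_number_lemma_of_metric hK
    (c := fun x => interior (V x) ∩ ball x (ε / 2))
    (fun x => isOpen_interior.inter isOpen_ball)
    (fun x _ => Set.mem_iUnion.2 ⟨x, mem_interior_iff_mem_nhds.2 (hV x),
      mem_ball_self (half_pos hε)⟩)
  refine ⟨δ, hδ, fun x hx => ?_⟩
  obtain ⟨z, hz⟩ := hδV x hx
  refine (hVU z).mono (fun y hy => interior_subset (hz hy).1) (ball_subset_ball' ?_)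
  have := (hz (mem_ball_self hδ)).2
  rw [mem_ball, dist_comm] at this
  linarith

theorem IsSemilocallyExtendable.exists_uniform {X : Type*} [PseudoMetricSpace X] {k : ℕ}
    (h : IsSemilocallyExtendable k X) {K : Set X} (hK : IsCompact K) :
    ∃ δ > 0, ∀ x ∈ K, ExtendsOver k (ball x δ) Set.univ := by
  choose V hV hVU using h
  obtain ⟨δ, hδ, hδV⟩ := lebesgue_number_lemma_of_metric hK
    (c := fun x => interior (V x)) (fun x => isOpen_interior)
    (fun x _ => Set.mem_iUnion.2 ⟨x, mem_interior_iff_mem_nhds.2 (hV x)⟩)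
  refine ⟨δ, hδ, fun x hx => ?_⟩
  obtain ⟨z, hz⟩ := hδV x hx
  exact (hVU z).mono (hz.trans interior_subset) subset_rfl

/-! ### Passage to path spaces -/

theorem Path.nhds_basis_dist {X : Type*} [PseudoMetricSpace X] {x y : X} (p : Path x y) :
    (𝓝 p).HasBasis (fun ε : ℝ => 0 < ε) fun ε => {q | ∀ t, dist (q t) (p t) < ε} := by
  rw [nhds_induced]
  refine (Metric.nhds_basis_ball.comap _).congr (fun _ => Iff.rfl) fun ε hε => ?_
  ext q
  exact ContinuousMap.dist_lt_iff hε

/-- Extension of families of paths, phrased in the path space. -/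
theorem ExtendsOver.path {X : Type*} [PseudoMetricSpace X] {m : ℕ} {x y : X}
    (p : Path x y) {η δ : ℝ} (hη : 0 < η) (hδη : δ ≤ η / 2)
    (h₁ : ∀ t, ExtendsOver m (ball (p t) δ) (ball (p t) (η / 2)))
    (T : I → Set X) (hpT : ∀ t, p t ∈ T t)
    (h₂ : ∀ t, ExtendsOver (m + 1) (ball (p t) η) (T t)) :
    ExtendsOver m {q : Path x y | ∀ t, dist (q t) (p t) < δ}
      {q | ∀ t, ∃ t', dist (p t) (p t') < η / 2 ∧ q t ∈ T t'} := by
  intro f hf hfV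
  obtain ⟨G, hG, hGf, hG0, hG1, hGT⟩ := ExtendsOver.exists_family_of_paths p hη hδη h₁ T hpT h₂
    (fun s t => f s t)
    (by
      rw [continuousOn_iff_continuous_domRestrict] at hf
      have := Path.continuous_uncurry_iff.2 hf
      rw [continuousOn_iff_continuous_domRestrict]
      exact this.comp (f := fun z : ↥(Cube.boundary (Fin (m + 1)) ×ˢ (Set.univ : Set I)) =>
        ((⟨z.1.1, z.2.1⟩ : Cube.boundary (Fin (m + 1))), z.1.2)) (by fun_prop))
    (fun s _ => (f s).source) (fun s _ => (f s).target) (fun s hs t => hfV hs t)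
  refine ⟨fun s => ⟨⟨G s, by fun_prop⟩, hG0 s, hG1 s⟩, Path.continuous_uncurry_iff.1 hG,
    hGT, fun s hs => ?_⟩
  ext t
  exact congrFun (hGf s hs) t

theorem IsLocallyExtendable.path {X : Type*} [TopologicalSpace X]
    [TopologicalSpace.PseudoMetrizableSpace X] {m : ℕ} (h : IsLocallyExtendable m X)
    (h' : IsLocallyExtendable (m + 1) X) (x y : X) : IsLocallyExtendable m (Path x y) := by
  let := TopologicalSpace.pseudoMetrizableSpacePseudoMetric X
  intro p U hU
  obtain ⟨ε, hε, hεU⟩ := p.nhds_basis_dist.mem_iff.1 hU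
  have hK := isCompact_range p.continuous
  -- Half of `ε` bounds the fillings and, through `min η ε`, the other half bounds the drift of `p`
  -- between `t` and `t'`.
  obtain ⟨η, hη, hη'⟩ := h'.exists_uniform hK (half_pos hε)
  obtain ⟨δ, hδ, hδ'⟩ := h.exists_uniform hK (half_pos (lt_min hη hε))
  refine ⟨_, p.nhds_basis_dist.mem_of_mem (lt_min hδ (half_pos (lt_min hη hε))),
    (ExtendsOver.path p (lt_min hη hε) (min_le_right _ _)
      (fun t => (hδ' _ ⟨t, rfl⟩).mono (ball_subset_ball (min_le_left _ _)) subset_rfl)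
      (fun t => ball (p t) (ε / 2)) (fun t => mem_ball_self (half_pos hε))
      (fun t => (hη' _ ⟨t, rfl⟩).mono (ball_subset_ball (min_le_left _ _)) subset_rfl)).mono
      subset_rfl fun q hq => hεU fun t => ?_⟩
  obtain ⟨t', h1, h2⟩ := hq t
  have h3 := min_le_right η ε
  have h4 := dist_triangle_right (q t) (p t) (p t')
  rw [mem_ball] at h2
  linarith

/-- Only the prisms need degree `m + 1`, and here nothing is asked of where they go. The slices must
stay near `p`, which is why degree `m` remains local. -/
theorem IsSemilocallyExtendable.path {X : Type*} [TopologicalSpace X]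
    [TopologicalSpace.PseudoMetrizableSpace X] {m : ℕ} (h : IsLocallyExtendable m X)
    (h' : IsSemilocallyExtendable (m + 1) X) (x y : X) :
    IsSemilocallyExtendable m (Path x y) := by
  let := TopologicalSpace.pseudoMetrizableSpacePseudoMetric X
  intro p
  have hK := isCompact_range p.continuous
  obtain ⟨η, hη, hη'⟩ := h'.exists_uniform hK
  obtain ⟨δ, hδ, hδ'⟩ := h.exists_uniform hK (half_pos hη)
  exact ⟨_, p.nhds_basis_dist.mem_of_mem (lt_min hδ (half_pos hη)),
    (ExtendsOver.path p hη (min_le_right _ _)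
      (fun t => (hδ' _ ⟨t, rfl⟩).mono (ball_subset_ball (min_le_left _ _)) subset_rfl)
      (fun t => Set.univ) (fun t => trivial) (fun t => hη' _ ⟨t, rfl⟩)).mono
      subset_rfl (Set.subset_univ _)⟩

/-! ### Iterated loop spaces and countability -/

instance GenLoop.pseudoMetrizableSpace {N X : Type*} [TopologicalSpace X]
    [TopologicalSpace.PseudoMetrizableSpace X] (x : X) [Finite N] :
    TopologicalSpace.PseudoMetrizableSpace (Ω^ N X x) := by
  have := Fintype.ofFinite N
  exact inferInstanceAs (TopologicalSpace.PseudoMetrizableSpace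
    {p : C(N → I, X) // p ∈ GenLoop N X x})

/-- Each loop coordinate costs one degree: `Ω^N X` is the loop space of the loops in the remaining
coordinates. Arbitrary finite index types are needed because removing a coordinate yields a subtype.
-/
theorem GenLoop.isExtendable {X : Type*} [TopologicalSpace X]
    [TopologicalSpace.PseudoMetrizableSpace X] (n : ℕ) (hloc : ∀ k < n, IsLocallyExtendable k X)
    (hsemi : IsSemilocallyExtendable n X) (x : X) {j k : ℕ} (hjk : j + k = n)
    (N : Type) [Fintype N] [DecidableEq N] (hN : Fintype.card N = j) :
    (∀ i < k, IsLocallyExtendable i (Ω^ N X x)) ∧ IsSemilocallyExtendable k (Ω^ N X x) := by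
  induction j generalizing k N with
  | zero =>
    obtain rfl : k = n := by omega
    have := Fintype.card_eq_zero_iff.1 hN
    let e : Ω^ N X x ≃ₜ X :=
      { toFun := fun p => p 0
        invFun := fun z => ⟨ContinuousMap.const _ z, fun _ h => h.elim fun i => isEmptyElim i⟩
        left_inv := fun p => by ext t; exact congrArg p (Subsingleton.elim _ _)
        right_inv := fun z => rfl
        continuous_toFun := by fun_prop
        continuous_invFun := Continuous.subtype_mk ContinuousMap.continuous_const' _ }
    exact ⟨fun i hi => (hloc i hi).of_homeomorph e, hsemi.of_homeomorph e⟩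
  | succ j ih =>
    obtain ⟨a⟩ : Nonempty N := Fintype.card_pos_iff.1 (by omega)
    obtain ⟨h1, h2⟩ := ih (k := k + 1) (by omega) {i : N // i ≠ a}
      (by rw [Fintype.card_subtype_compl, Fintype.card_subtype_eq, hN]; rfl)
    have e := GenLoop.loopHomeo (X := X) (x := x) a
    exact ⟨fun i hi => ((h1 i (by omega)).path (h1 (i + 1) (by omega)) _ _).of_homeomorph e,
      (IsSemilocallyExtendable.path (h1 k (by omega)) h2 _ _).of_homeomorph e⟩

theorem ExtendsOver.joinedIn {Y : Type*} [TopologicalSpace Y] {V U : Set Y}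
    (h : ExtendsOver 0 V U) {y z : Y} (hy : y ∈ V) (hz : z ∈ V) : JoinedIn U y z := by
  classical
  -- The boundary of the 1-cube is two points, so continuity on it is automatic.
  obtain ⟨g, hg, hgU, hgf⟩ := h (fun t => if t 0 = 0 then y else z)
    (Set.Finite.continuousOn (Set.Finite.subset
      (Set.toFinite {(fun _ => 0 : Fin 1 → I), (fun _ => 1 : Fin 1 → I)}) (by
        rintro t ⟨i, hi⟩
        refine hi.imp (fun h => ?_) (fun h => ?_) <;>
        · funext j
          rw [Subsingleton.elim (α := Fin 1) j i, h])) _)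
    (fun t _ => by
      dsimp only
      split_ifs
      exacts [hy, hz])
  refine ⟨⟨⟨fun r => g fun _ => r, by fun_prop⟩, ?_, ?_⟩, fun r => hgU _⟩
  · simpa using hgf (x := fun _ => 0) ⟨0, Or.inl rfl⟩
  · simpa using hgf (x := fun _ => 1) ⟨0, Or.inr rfl⟩

theorem IsSemilocallyExtendable.exists_nhds_joined {Y : Type*} [TopologicalSpace Y]
    (h : IsSemilocallyExtendable 0 Y) (y : Y) : ∃ V ∈ 𝓝 y, ∀ z ∈ V, Joined y z := by
  obtain ⟨V, hV, hVU⟩ := h y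
  exact ⟨V, hV, fun z hz => (hVU.joinedIn (mem_of_mem_nhds hV) hz).joined⟩

theorem GenLoop.homotopic_of_joined {N X : Type*} [TopologicalSpace X] {x : X} {p q : Ω^ N X x}
    (h : Joined p q) : GenLoop.Homotopic p q := by
  obtain ⟨γ⟩ := h
  refine ⟨⟨⟨⟨fun z => γ z.1 z.2, by fun_prop⟩, fun t => ?_, fun t => ?_⟩, fun r t ht => ?_⟩⟩
  · exact congrArg (fun u : Ω^ N X x => u t) γ.source
  · exact congrArg (fun u : Ω^ N X x => u t) γ.target
  · exact ((γ r).2 t ht).trans (p.2 t ht).symm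

theorem HomotopyGroup.countable_of_isSemilocallyExtendable {N X : Type*} [Finite N]
    [TopologicalSpace X] [SecondCountableTopology X] {x : X}
    (h : IsSemilocallyExtendable 0 (Ω^ N X x)) : Countable (HomotopyGroup N X x) := by
  have : SecondCountableTopology (Ω^ N X x) :=
    inferInstanceAs (SecondCountableTopology {p : C(N → I, X) // p ∈ GenLoop N X x})
  obtain ⟨s, hs, hd⟩ := TopologicalSpace.exists_countable_dense (Ω^ N X x)
  have := hs.to_subtype
  refine Function.Surjective.countable (f := fun p : s => (⟦p.1⟧ : HomotopyGroup N X x)) ?_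
  rintro ⟨p⟩
  obtain ⟨V, hV, hVp⟩ := h.exists_nhds_joined p
  obtain ⟨q, hqV, hqs⟩ := hd.inter_nhds_nonempty hV
  exact ⟨⟨q, hqV⟩, Quotient.sound (GenLoop.homotopic_of_joined (hVp q hqs)).symm⟩

/-! ### Homotopy extension for the cube -/

theorem Cube.mem_boundary_iff_norm {m : ℕ} {s : Fin m → I} :
    s ∈ Cube.boundary (Fin m) ↔ ‖fun i => 2 * (s i : ℝ) - 1‖ = 1 := by
  have habs : ∀ i, |2 * (s i : ℝ) - 1| ≤ 1 := fun i =>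
    abs_le.2 ⟨by linarith [(s i).2.1], by linarith [(s i).2.2]⟩
  have hone : ∀ i, (s i = 0 ∨ s i = 1) ↔ |2 * (s i : ℝ) - 1| = 1 := fun i => by
    rw [abs_eq zero_le_one, Subtype.ext_iff, Subtype.ext_iff, or_comm]
    refine or_congr ⟨fun h => ?_, fun h => ?_⟩ ⟨fun h => ?_, fun h => ?_⟩ <;>
      simp only [Set.Icc.coe_one, Set.Icc.coe_zero] at h ⊢ <;> linarith
  constructor
  · rintro ⟨i, hi⟩
    refine le_antisymm ((pi_norm_le_iff_of_nonneg zero_le_one).2 habs) ?_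
    refine ((hone i).1 hi).symm.le.trans ?_
    exact norm_le_pi_norm (fun i => 2 * (s i : ℝ) - 1) i
  · intro h
    by_contra hs
    refine h.not_lt ((pi_norm_lt_iff one_pos).2 fun i => lt_of_le_of_ne (habs i) fun hi => ?_)
    exact hs ⟨i, (hone i).2 hi⟩

/-- The prism `I^m × I` retracts onto the union of its bottom and its sides. -/
theorem Cube.exists_retraction_openBox (m : ℕ) :
    ∃ ρ : C((Fin m → I) × I, (Fin m → I) × I),
      (∀ z, (ρ z).2 = 0 ∨ (ρ z).1 ∈ Cube.boundary (Fin m)) ∧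
      ∀ z : (Fin m → I) × I, (z.2 = 0 ∨ z.1 ∈ Cube.boundary (Fin m)) → ρ z = z := by
  -- Radial projection from the point at height 2 above the centre, in coordinates `c` in `[-1, 1]`.
  -- The ray is scaled by `1 / M`: the first term of the maximum corresponds to hitting the bottom,
  -- the second to hitting a side.
  set c : (Fin m → I) × I → Fin m → ℝ := fun z i => 2 * (z.1 i : ℝ) - 1 with hc
  set M : (Fin m → I) × I → ℝ := fun z => max ((2 - (z.2 : ℝ)) / 2) ‖c z‖ with hM
  have hcc : Continuous c := by fun_prop
  have hMc : Continuous M := by fun_prop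
  have hc1 : ∀ z, ‖c z‖ ≤ 1 := fun z => (pi_norm_le_iff_of_nonneg zero_le_one).2 fun i =>
    abs_le.2 ⟨by linarith [(z.1 i).2.1], by linarith [(z.1 i).2.2]⟩
  have hMpos : ∀ z, 0 < M z := fun z =>
    lt_of_lt_of_le (by linarith [z.2.2.2]) (le_max_left _ _)
  have hM1 : ∀ z, M z ≤ 2 - (z.2 : ℝ) := fun z =>
    max_le (by linarith [z.2.2.2]) (by linarith [z.2.2.2, hc1 z])
  have hMl : ∀ z, (2 - (z.2 : ℝ)) / 2 ≤ M z := fun z => le_max_left _ _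
  have hMr : ∀ z, ‖c z‖ ≤ M z := fun z => le_max_right _ _
  have hI1 : ∀ z i, (c z i / M z + 1) / 2 ∈ I := fun z i => by
    have h : |c z i / M z| ≤ 1 := by
      rw [abs_div, abs_of_pos (hMpos z), div_le_one (hMpos z)]
      exact (norm_le_pi_norm (c z) i).trans (hMr z)
    rw [abs_le] at h
    exact ⟨by linarith [h.1], by linarith [h.2]⟩
  have hI2 : ∀ z : (Fin m → I) × I, 2 - (2 - (z.2 : ℝ)) / M z ∈ I := fun z => by
    constructor
    · rw [sub_nonneg, div_le_iff₀ (hMpos z)]; linarith [hMl z]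
    · have : 1 ≤ (2 - (z.2 : ℝ)) / M z := by rw [le_div_iff₀ (hMpos z)]; linarith [hM1 z]
      linarith
  refine ⟨⟨fun z => (fun i => ⟨_, hI1 z i⟩, ⟨_, hI2 z⟩), ?_⟩, fun z => ?_, fun z hz => ?_⟩
  · have := fun z => (hMpos z).ne'
    refine Continuous.prodMk (continuous_pi fun i => Continuous.subtype_mk ?_ _)
      (Continuous.subtype_mk ?_ _)
    · exact ((((continuous_apply i).comp hcc).div hMc this).add continuous_const).div_const _
    · exact continuous_const.sub
        ((continuous_const.sub (continuous_subtype_val.comp continuous_snd)).div hMc this)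
  · rcases max_choice ((2 - (z.2 : ℝ)) / 2) ‖c z‖ with h | h
    · left
      have h' : M z = (2 - (z.2 : ℝ)) / 2 := h
      have := hMpos z
      rw [Subtype.ext_iff]
      change 2 - (2 - (z.2 : ℝ)) / M z = 0
      rw [sub_eq_zero, eq_div_iff this.ne', h']
      ring
    · right
      have h' : M z = ‖c z‖ := h
      rw [Cube.mem_boundary_iff_norm]
      have : (fun i => 2 * ((c z i / M z + 1) / 2) - 1) = (M z)⁻¹ • c z := by
        funext i
        simp only [Pi.smul_apply, smul_eq_mul]
        ring
      change ‖fun i => 2 * ((c z i / M z + 1) / 2) - 1‖ = 1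
      rw [this, norm_smul, norm_inv, Real.norm_of_nonneg (hMpos z).le, ← h',
        inv_mul_cancel₀ (hMpos z).ne']
  · have hMz : M z = 1 := by
      refine le_antisymm (max_le (by linarith [z.2.2.1]) (hc1 z)) ?_
      rcases hz with hz | hz
      · refine le_trans ?_ (hMl z)
        simp [hz]
      · exact (Cube.mem_boundary_iff_norm.1 hz).symm.le.trans (hMr z)
    refine Prod.ext (funext fun i => Subtype.ext ?_) (Subtype.ext ?_)
    · change (c z i / M z + 1) / 2 = z.1 i
      rw [hMz, hc]; ring
    · change 2 - (2 - (z.2 : ℝ)) / M z = z.2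
      rw [hMz]; ring

open Classical in
/-- The homotopy extension property of the cube relative to its boundary. -/
theorem Cube.exists_homotopy_extension {Y : Type*} [TopologicalSpace Y] {m : ℕ}
    {A : (Fin m → I) → Y} (hA : Continuous A) {B : (Fin m → I) → I → Y}
    (hB : ContinuousOn (Function.uncurry B) (Cube.boundary (Fin m) ×ˢ Set.univ))
    (hAB : ∀ s ∈ Cube.boundary (Fin m), B s 0 = A s) :
    ∃ H : (Fin m → I) → I → Y, Continuous (Function.uncurry H) ∧ (∀ s, H s 0 = A s) ∧
      ∀ s ∈ Cube.boundary (Fin m), H s = B s := by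
  obtain ⟨ρ, hρ, hρ'⟩ := Cube.exists_retraction_openBox m
  set f : (Fin m → I) × I → Y := fun z =>
    if z.1 ∈ Cube.boundary (Fin m) then B z.1 z.2 else A z.1 with hf
  have fB : ∀ s ∈ Cube.boundary (Fin m), ∀ r, f (s, r) = B s r := fun s hs r => by simp [hf, hs]
  have fA : ∀ s, f (s, 0) = A s := fun s => by
    by_cases hs : s ∈ Cube.boundary (Fin m)
    · rw [fB s hs, hAB s hs]
    · simp [hf, hs]
  have hfc : ContinuousOn f
      ({z | z.2 = 0} ∪ Cube.boundary (Fin m) ×ˢ (Set.univ : Set I)) := by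
    refine ContinuousOn.union_of_isClosed ?_ ?_ (isClosed_eq continuous_snd continuous_const)
      ((Cube.isClosed_boundary _).prod isClosed_univ)
    · refine (hA.comp continuous_fst).continuousOn.congr ?_
      rintro ⟨s, r⟩ (rfl : r = 0)
      exact fA s
    · exact hB.congr fun z hz => fB z.1 hz.1 z.2
  refine ⟨fun s r => f (ρ (s, r)), ?_, fun s => ?_, fun s hs => funext fun r => ?_⟩
  · exact hfc.comp_continuous ρ.continuous fun z => (hρ z).imp id fun h => ⟨h, trivial⟩
  · exact (congrArg f (hρ' (s, 0) (Or.inl rfl))).trans (fA s)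
  · exact (congrArg f (hρ' (s, r) (Or.inr hs))).trans (fB s hs r)

/-- A map from the prism `I^m × I` is homotopic to any constant map with value in the path
component of its value at the origin. -/
theorem Cube.homotopic_const_of_joined {Y : Type*} [TopologicalSpace Y] {m : ℕ}
    (g : C((Fin m → I) × I, Y)) {y : Y} (h : Joined (g (0, 0)) y) :
    g.Homotopic (ContinuousMap.const _ y) := by
  refine ContinuousMap.Homotopic.trans (g := ContinuousMap.const _ (g (0, 0))) ?_
    (ContinuousMap.homotopic_const_iff.2 h)
  refine ⟨⟨⟨fun z => g (fun i => unitInterval.symm z.1 * z.2.1 i,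
    unitInterval.symm z.1 * z.2.2), by fun_prop⟩, fun z => ?_, fun z => ?_⟩⟩
  · simp
  · simp; rfl

/-! ### From homotopy groups to fillings of spheres -/

/-- If the inclusion `U → X` kills `π_n(U, x)`, then a map of the boundary of the `(n + 1)`-cube
into the path component of `x` in `U` extends to a map of the cube into `X`. -/
theorem ExtendsOver.of_induced_eq_const {X : Type*} [TopologicalSpace X] {n : ℕ} {U V : Set X}
    {x : X} (hxU : x ∈ U)
    (hnull : ∀ a : π_ n U ⟨x, hxU⟩,
      HomotopyGroup.induced n (⟨Subtype.val, continuous_subtype_val⟩ : C(U, X)) ⟨x, hxU⟩ a =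
        (⟦GenLoop.const⟧ : π_ n X x))
    (hVU : ∀ y ∈ V, JoinedIn U y x) : ExtendsOver n V Set.univ := by
  classical
  intro f hf hfV
  -- The value `x` off `f ⁻¹' U` is a dummy: on the boundary `f` lands in `U`.
  set e : (Fin (n + 1) → I) → U := fun z => if h : f z ∈ U then ⟨f z, h⟩ else ⟨x, hxU⟩ with he
  have hev : ∀ z ∈ Cube.boundary (Fin (n + 1)), (e z : X) = f z := fun z hz => by
    simp [he, (hVU _ (hfV hz)).source_mem]
  have hec : ContinuousOn e (Cube.boundary (Fin (n + 1))) := by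
    rw [Topology.IsEmbedding.subtypeVal.continuousOn_iff]
    exact hf.congr hev
  have hconsc : Continuous fun z : (Fin n → I) × I => (Fin.cons z.2 z.1 : Fin (n + 1) → I) :=
    Continuous.finCons continuous_snd continuous_fst
  have hbot : ∀ s : Fin n → I, (Fin.cons 0 s : Fin (n + 1) → I) ∈ Cube.boundary (Fin (n + 1)) :=
    fun s => Cube.cons_mem_boundary_iff.2 (Or.inl rfl)
  have htop : ∀ s : Fin n → I, (Fin.cons 1 s : Fin (n + 1) → I) ∈ Cube.boundary (Fin (n + 1)) :=
    fun s => Cube.cons_mem_boundary_iff.2 (Or.inr (Or.inl rfl))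
  have hside : ∀ s ∈ Cube.boundary (Fin n), ∀ r,
      (Fin.cons r s : Fin (n + 1) → I) ∈ Cube.boundary (Fin (n + 1)) :=
    fun s hs r => Cube.cons_mem_boundary_iff.2 (Or.inr (Or.inr hs))
  -- extend `e` from the bottom and the sides to the prism, and contract the result to `x` in `U`
  obtain ⟨g, hg, hg0, hgs⟩ := Cube.exists_homotopy_extension (m := n)
    (A := fun s => e (Fin.cons 0 s)) (B := fun s r => e (Fin.cons r s))
    (hec.comp_continuous (hconsc.comp (continuous_id.prodMk continuous_const)) hbot)
    (hec.comp hconsc.continuousOn fun z hz => hside _ hz.1 _) (fun s _ => rfl)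
  have hj : Joined (g 0 0) ⟨x, hxU⟩ := by
    have h := hVU (f (Fin.cons 0 0)) (hfV (hbot 0))
    have h' := joinedIn_iff_joined h.source_mem hxU |>.1 h
    convert h' using 1
    rw [hg0]
    exact Subtype.ext (hev _ (hbot 0))
  obtain ⟨Φ⟩ := Cube.homotopic_const_of_joined ⟨Function.uncurry g, hg⟩ hj
  have hΦ0 : ∀ z, Φ (0, z) = g z.1 z.2 := fun z => Φ.map_zero_left z
  have hΦ1 : ∀ z, Φ (1, z) = ⟨x, hxU⟩ := fun z => Φ.map_one_left z
  -- carry the homotopy over to the top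
  obtain ⟨Ψ, hΨ, hΨ0, hΨs⟩ := Cube.exists_homotopy_extension (m := n)
    (A := fun s => e (Fin.cons 1 s)) (B := fun s w => Φ (w, (s, 1)))
    (hec.comp_continuous (hconsc.comp (continuous_id.prodMk continuous_const)) htop)
    (Continuous.continuousOn (by unfold Function.uncurry; fun_prop))
    (fun s hs => by rw [hΦ0, hgs s hs])
  -- the top has become a loop
  let p : Ω^ (Fin n) U ⟨x, hxU⟩ :=
    ⟨⟨fun s => Ψ s 1, hΨ.comp (continuous_id.prodMk continuous_const)⟩, fun s hs => by
      change Ψ s 1 = _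
      exact (congrFun (hΨs s hs) 1).trans (hΦ1 _)⟩
  obtain ⟨K⟩ : GenLoop.Homotopic (GenLoop.postcomp ⟨Subtype.val, continuous_subtype_val⟩ _ p)
    (GenLoop.const : Ω^ (Fin n) X x) := Quotient.exact (hnull ⟦p⟧)
  have hK0 : ∀ s, K (0, s) = Ψ s 1 := fun s => K.map_zero_left s
  have hK1 : ∀ s, K (1, s) = x := fun s => K.map_one_left s
  have hKs : ∀ s ∈ Cube.boundary (Fin n), ∀ r, K (r, s) = x := fun s hs r =>
    (K.eq_fst r hs).trans (congrArg Subtype.val (p.2 s hs))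
  -- The deformation of the boundary run backwards: at time 0 it is `p` on the top and `x`
  -- elsewhere, at time 1 it is `f`.
  set B : (Fin (n + 1) → I) → I → X := fun z w =>
    if z 0 = 1 then Ψ (Fin.tail z) (unitInterval.symm w)
    else Φ (unitInterval.symm w, (Fin.tail z, z 0)) with hB
  have hB1 : ∀ s w, B (Fin.cons 1 s) w = Ψ s (unitInterval.symm w) := fun s w => by simp [hB]
  have hB0 : ∀ r s w, (r = 0 ∨ s ∈ Cube.boundary (Fin n)) →
      B (Fin.cons r s) w = Φ (unitInterval.symm w, (s, r)) := by
    intro r s w h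
    by_cases hr : r = 1
    · subst hr
      have hs := h.resolve_left one_ne_zero
      rw [hB1, hΨs s hs]
    · simp [hB, hr]
  have htail : Continuous (fun z : Fin (n + 1) → I => Fin.tail z) := by
    unfold Fin.tail; fun_prop
  have hbd : Cube.boundary (Fin (n + 1)) ×ˢ (Set.univ : Set I) =
      {z | z.1 0 = 1} ∪ ({z | z.1 0 = 0} ∪
        (fun z : (Fin (n + 1) → I) × I => Fin.tail z.1) ⁻¹' Cube.boundary (Fin n)) := by
    ext ⟨z, w⟩
    induction z using Fin.consCases with
    | cons r s => simp [Cube.cons_mem_boundary_iff]; tauto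
  have hBc : ContinuousOn (Function.uncurry B) (Cube.boundary (Fin (n + 1)) ×ˢ Set.univ) := by
    rw [hbd]
    have k0 : IsClosed {z : (Fin (n + 1) → I) × I | z.1 0 = 0} :=
      isClosed_eq (by fun_prop) (by fun_prop)
    have k1 : IsClosed {z : (Fin (n + 1) → I) × I | z.1 0 = 1} :=
      isClosed_eq (by fun_prop) (by fun_prop)
    refine ContinuousOn.union_of_isClosed ?_ ?_ k1
      (k0.union ((Cube.isClosed_boundary _).preimage (htail.comp continuous_fst)))
    · have : Continuous fun z : (Fin (n + 1) → I) × I =>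
          ((Function.uncurry Ψ (Fin.tail z.1, unitInterval.symm z.2) : U) : X) := by fun_prop
      refine this.continuousOn.congr ?_
      rintro ⟨z, w⟩ (hz : z 0 = 1)
      simp [hB, hz]
    · have : Continuous fun z : (Fin (n + 1) → I) × I =>
          ((Φ (unitInterval.symm z.2, (Fin.tail z.1, z.1 0)) : U) : X) := by fun_prop
      refine this.continuousOn.congr ?_
      rintro ⟨z, w⟩ hz
      have := hB0 (z 0) (Fin.tail z) w hz
      rwa [Fin.cons_self_tail] at this
  -- The nullhomotopy `K`, with its time as the first coordinate reversed, fills the deformed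
  -- boundary map; extending `B` from it carries the filling back to `f`.
  obtain ⟨H, hH, -, hHs⟩ := Cube.exists_homotopy_extension (m := n + 1)
    (A := fun z => K (unitInterval.symm (z 0), Fin.tail z)) (B := B) (by fun_prop) hBc (by
      intro z hz
      induction z using Fin.consCases with
      | cons r s =>
        by_cases hr : r = 1
        · subst hr
          rw [hB1]; simp [hK0]
        · have h := (Cube.cons_mem_boundary_iff.1 hz)
          have h' : r = 0 ∨ s ∈ Cube.boundary (Fin n) := by tauto
          rw [hB0 r s 0 h', unitInterval.symm_zero, hΦ1]
          rcases h' with rfl | hs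
          · simp [hK1]
          · simp [hKs s hs])
  refine ⟨fun z => H z 1, hH.comp (continuous_id.prodMk continuous_const), fun _ => trivial,
    fun z hz => ?_⟩
  change H z 1 = f z
  rw [hHs z hz, ← hev z hz]
  induction z using Fin.consCases with
  | cons r s =>
    by_cases hr : r = 1
    · subst hr
      rw [hB1, unitInterval.symm_one, hΨ0]
    · have h := (Cube.cons_mem_boundary_iff.1 hz)
      have h' : r = 0 ∨ s ∈ Cube.boundary (Fin n) := by tauto
      rw [hB0 r s 1 h', unitInterval.symm_one, hΦ0]
      rcases h' with rfl | hs
      · rw [hg0]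
      · rw [hgs s hs]

theorem IsLocallyNConnected.isLocallyExtendable {X : Type*} [TopologicalSpace X] {m k : ℕ}
    (h : IsLocallyNConnected m X) (hk : k ≤ m) : IsLocallyExtendable k X := by
  intro x U hU
  obtain ⟨V, hV, -, hVU⟩ := h x U hU
  refine ⟨V, hV, fun f hf hfV => ?_⟩
  obtain ⟨g, hg, hgf⟩ := hVU k hk ⟨_, hf.domRestrict⟩ fun t => hfV t.2
  exact ⟨g, g.continuous, hg, fun t ht => hgf ⟨t, ht⟩⟩

/-- Local extendability in degree 0 shrinks `U` to a `V` whose points are joined to `x` inside `U`,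
which lets free spheres be based at `x`. -/
theorem IsSemilocallyNConnected.isSemilocallyExtendable {X : Type*} [TopologicalSpace X] {n : ℕ}
    (h : IsSemilocallyNConnected n X) (h₀ : IsLocallyExtendable 0 X) :
    IsSemilocallyExtendable n X := by
  intro x
  obtain ⟨U, hU, hnull⟩ := h x
  obtain ⟨V, hV, hVU⟩ := h₀ x U hU
  exact ⟨V, hV, ExtendsOver.of_induced_eq_const (mem_of_mem_nhds hU) hnull
    fun y hy => hVU.joinedIn hy (mem_of_mem_nhds hV)⟩

theorem theorem3p2 {X : Type*} [MetricSpace X] [TopologicalSpace.SeparableSpace X]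
    (n : ℕ) (hn : 1 ≤ n)
    (hconn : IsNConnected (n - 1) X)
    (hloc : IsLocallyNConnected (n - 1) X)
    (hsemi : IsSemilocallyNConnected n X) (x : X) :
    Countable (π_ n X x) := by
  have := UniformSpace.secondCountable_of_separable X
  exact HomotopyGroup.countable_of_isSemilocallyExtendable
    (GenLoop.isExtendable n (fun k hk => hloc.isLocallyExtendable (by omega))
      (hsemi.isSemilocallyExtendable (hloc.isLocallyExtendable (Nat.zero_le _))) x
      (Nat.add_zero n) (Fin n) (Fintype.card_fin n)).2
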